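/- Let $\mathfrak{sl}_2$ be the Lie algebra of traceless complex $2\times 2$ matrices with standard basis $e,f,h$ ($[e,f]=h$, $[h,e]=2e$, $[h,f]=-2f$), let $\mathfrak g=\mathfrak{sl}_2\oplus\mathfrak{sl}_2$ with $e_1=(e,0)$, $e_2=(0,e)$, $h_1=(h,0)$, $h_2=(0,h)$, and let $\theta$ be the involution of $\mathfrak g$ that exchanges the two summands. Extend $\theta$ to the loop algebra $\mathcal L=\mathbb C[t,t^{-1}]\otimes\mathfrak g$ by $\theta(t^n\otimes x)=t^{-n}\otimes\theta(x)$, and let $\mathcal L^{\mathrm{tw}}=\{x\in\mathcal L\mid\theta(x)=x\}$ (the twisted loop algebra of the second kind of type $\Delta A_1$). Put $\mathcal L^{\mathrm{tw},+}=\mathcal L^{\mathrm{tw}}\cap(\mathbb C[t,t^{-1}]\otimes\operatorname{Span}\{e_1,e_2\})$, $\mathcal L^{\mathrm{tw},0}=\mathcal L^{\mathrm{tw}}\cap(\mathbb C[t,t^{-1}]\otimes\operatorname{Span}\{h_1,h_2\})$, and $w_a=t^a\otimes h_1+t^{-a}\otimes h_2\in\mathcal L^{\mathrm{tw},0}$ for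 $a\in\mathbb Z$. For a linear functional $\phi$ on $\mathcal L^{\mathrm{tw},0}$, let $M(\phi)$ be the quotient of the universal enveloping algebra $U(\mathcal L^{\mathrm{tw}})$ by the left ideal generated by $\mathcal L^{\mathrm{tw},+}$ and all $w-\phi(w)$, $w\in\mathcal L^{\mathrm{tw},0}$, and let $V(\phi)$ be the unique simple quotient of $M(\phi)$, i.e. the quotient of $M(\phi)$ by the sum of all its proper submodules. Then $\mathcal L^{\mathrm{tw}}$ is isomorphic, as a Lie algebra over $\mathbb C$, to the loop algebra $\mathbb C[t,t^{-1}]\otimes\mathfrak{sl}_2$. Moreover, for every linear functional $\phi:\mathcal L^{\mathrm{tw},0}\to\mathbb C$, the following are equivalent: 1. $\dim_{\mathbb C} V(\phi)<\infty$; 2. there exist an integer $n\ge 0$ and $\alpha_1,\dots,\alpha_n\in\mathbb C^\times$ such that $\phi(w_a)=\sum_{i=1}^n\alpha_i^a$ for all $a\in\mathbb Z$. -/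

import Mathlib

open scoped TensorProduct LaurentPolynomial

noncomputable section

namespace TwistedLoop

/-! ### Loop algebras and twisted loop algebras of the second kind -/

section Loop

variable {g : Type} [LieRing g] [LieAlgebra ℂ g]

/-- The loop algebra `ℂ[t, t⁻¹] ⊗ g`, with bracket `[P ⊗ x, Q ⊗ y] = P Q ⊗ [x, y]`. -/
abbrev Loop (g : Type) [LieRing g] [LieAlgebra ℂ g] : Type :=
  ℂ[T;T⁻¹] ⊗[ℂ] g

/-- The extension of `θ : g → g` to the loop algebra: `t ^ n ⊗ x ↦ t ^ (-n) ⊗ θ x`. -/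
def loopTheta (θ : g →ₗ⁅ℂ⁆ g) : Loop g →ₗ⁅ℂ⁆ Loop g :=
  LieAlgebra.ExtendScalars.map (LaurentPolynomial.invert : ℂ[T;T⁻¹] ≃ₐ[ℂ] ℂ[T;T⁻¹]).toAlgHom θ

/-- The twisted loop algebra of the second kind: the fixed points of `θ` in the loop algebra. -/
def twisted (θ : g →ₗ⁅ℂ⁆ g) : LieSubalgebra ℂ (Loop g) where
  carrier := {x | loopTheta θ x = x}
  add_mem' {x y} hx hy := by
    simp only [Set.mem_ofPred_eq] at *
    rw [map_add, hx, hy]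
  zero_mem' := by simp
  smul_mem' c x hx := by
    simp only [Set.mem_ofPred_eq] at *
    rw [map_smul, hx]
  lie_mem' {x y} hx hy := by
    change loopTheta θ ⁅x, y⁆ = ⁅x, y⁆
    rw [LieHom.map_lie]
    exact congrArg₂ _ hx hy

/-- The subspace `ℂ[t, t⁻¹] ⊗ W` of the loop algebra, for a subspace `W` of `g`. -/
def loopSub (W : Submodule ℂ g) : Submodule ℂ (Loop g) :=
  LinearMap.range (W.subtype.lTensor ℂ[T;T⁻¹])

/-- The intersection of the twisted loop algebra with `ℂ[t, t⁻¹] ⊗ W`,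
as a subspace of the twisted loop algebra. -/
def twistedSub (θ : g →ₗ⁅ℂ⁆ g) (W : Submodule ℂ g) : Submodule ℂ (twisted θ) :=
  (loopSub W).comap (twisted θ).toSubmodule.subtype

end Loop

/-! ### Universal highest weight modules and their simple quotients -/

section HighestWeight

variable {A : Type} [LieRing A] [LieAlgebra ℂ A]

/-- The left ideal of `U(A)` generated by `P` and by the elements `w - φ w` for `w ∈ H`. -/
def hwIdeal (P H : Submodule ℂ A) (φ : Module.Dual ℂ H) :
    Submodule (UniversalEnvelopingAlgebra ℂ A) (UniversalEnvelopingAlgebra ℂ A) :=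
  Submodule.span (UniversalEnvelopingAlgebra ℂ A)
    ({u | ∃ x ∈ P, u = UniversalEnvelopingAlgebra.ι ℂ x} ∪
     {u | ∃ w : H, u = UniversalEnvelopingAlgebra.ι ℂ (w : A) -
        algebraMap ℂ (UniversalEnvelopingAlgebra ℂ A) (φ w)})

/-- The universal highest weight module `M(φ)`. -/
abbrev universalHW (P H : Submodule ℂ A) (φ : Module.Dual ℂ H) : Type :=
  UniversalEnvelopingAlgebra ℂ A ⧸ hwIdeal P H φ

/-- The largest proper submodule of `M(φ)`: the sum of all proper submodules. -/
def maxSubmodule (P H : Submodule ℂ A) (φ : Module.Dual ℂ H) :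
    Submodule (UniversalEnvelopingAlgebra ℂ A) (universalHW P H φ) :=
  sSup {N | N ≠ ⊤}

/-- The unique simple quotient `V(φ)` of `M(φ)`. -/
abbrev simpleHW (P H : Submodule ℂ A) (φ : Module.Dual ℂ H) : Type :=
  universalHW P H φ ⧸ maxSubmodule P H φ

end HighestWeight

/-! ### Type `ΔA₁` -/

/-- The Lie algebra `sl₂` over `ℂ`. -/
abbrev Sl2 : Type := LieAlgebra.SpecialLinear.sl (Fin 2) ℂ

def e : Sl2 := ⟨!![0, 1; 0, 0], by simp [LieAlgebra.SpecialLinear.sl, Matrix.trace_fin_two]⟩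

def f : Sl2 := ⟨!![0, 0; 1, 0], by simp [LieAlgebra.SpecialLinear.sl, Matrix.trace_fin_two]⟩

def h : Sl2 := ⟨!![1, 0; 0, -1], by simp [LieAlgebra.SpecialLinear.sl, Matrix.trace_fin_two]⟩

namespace DeltaA1

/-- The Chevalley generators of `sl₂ ⊕ sl₂` are `(e, 0), (f, 0), (h, 0)` (vertex `1`) and
`(0, e), (0, f), (0, h)` (vertex `2`); `θ` is the automorphism which exchanges the vertices. -/
def theta : Sl2 × Sl2 →ₗ⁅ℂ⁆ Sl2 × Sl2 :=
  LieHom.prod (LieHom.snd ℂ Sl2 Sl2) (LieHom.fst ℂ Sl2 Sl2)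

/-- The nilradical `n⁺` of `sl₂ ⊕ sl₂`, spanned by `e₁` and `e₂`. -/
def nPos : Submodule ℂ (Sl2 × Sl2) := Submodule.span ℂ {(e, 0), (0, e)}

/-- The Cartan subalgebra of `sl₂ ⊕ sl₂`, spanned by `h₁` and `h₂`. -/
def cartan : Submodule ℂ (Sl2 × Sl2) := Submodule.span ℂ {(h, 0), (0, h)}

/-- The twisted loop algebra of the second kind of type `ΔA₁`. -/
abbrev Ltw : LieSubalgebra ℂ (Loop (Sl2 × Sl2)) := twisted theta

/-- The positive part of the triangular decomposition of `Ltw`. -/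
abbrev LtwPos : Submodule ℂ Ltw := twistedSub theta nPos

/-- The zero part of the triangular decomposition of `Ltw`. -/
abbrev LtwZero : Submodule ℂ Ltw := twistedSub theta cartan

/-- The simple highest weight module `V(φ)`, a module over `U(Ltw)`. -/
abbrev V (φ : Module.Dual ℂ LtwZero) : Type := simpleHW LtwPos LtwZero φ

/-- The element `t ^ a ⊗ h₁ + t ^ (-a) ⊗ h₂` of the loop algebra. -/
def wLoop (a : ℤ) : Loop (Sl2 × Sl2) :=
  (LaurentPolynomial.T a : ℂ[T;T⁻¹]) ⊗ₜ[ℂ] ((h, 0) : Sl2 × Sl2) +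
    (LaurentPolynomial.T (-a) : ℂ[T;T⁻¹]) ⊗ₜ[ℂ] ((0, h) : Sl2 × Sl2)

theorem wLoop_mem_twisted (a : ℤ) : wLoop a ∈ Ltw := by
  change loopTheta theta (wLoop a) = wLoop a
  simp [loopTheta, wLoop, theta, add_comm]

theorem wLoop_mem_loopSub (a : ℤ) : wLoop a ∈ loopSub cartan := by
  refine Submodule.add_mem _ ?_ ?_
  · exact ⟨_ ⊗ₜ ⟨_, Submodule.subset_span (Or.inl rfl)⟩, rfl⟩
  · exact ⟨_ ⊗ₜ ⟨_, Submodule.subset_span (Or.inr rfl)⟩, rfl⟩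

/-- The element `w_a = t ^ a ⊗ h₁ + t ^ (-a) ⊗ h₂`, in the zero part of `Ltw`. -/
def w (a : ℤ) : LtwZero := ⟨⟨wLoop a, wLoop_mem_twisted a⟩, wLoop_mem_loopSub a⟩

end DeltaA1

end TwistedLoop

end

noncomputable section

namespace TwistedLoop

/-! A fixed point of `theta` in the loop algebra is determined by its first component, so `Ltw` is
the loop algebra of `sl₂` (`loopEquiv`). Under this isomorphism `a ⊗ e` spans the positive part, `a
⊗ h` spans the zero part, and `T n ⊗ h` corresponds to `w n`. Thus `φ` becomes a functional on the
ring `A` of Laurent polynomials.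

Suppose `V φ` is finite-dimensional, with highest weight vector `v`. Let `I` be the largest ideal of
`A` inside `ker φ`. Since `E b (F a v) = φ (b * a) • v`, simplicity gives `F a v = 0` exactly for `a
∈ I`, so `A ⧸ I` embeds into `V φ`. If `F (a * a) v = s • F a v`, an `sl₂` computation shows `φ a =
s * n` for some natural `n` (`exists_eq_mul_nat`). The case `s = 0` makes `A ⧸ I` reduced, hence a
product of copies of `ℂ`; the case `s = 1` makes `φ` a natural number on each lifted idempotent. So
`φ` is a sum of characters of `A`, and these are evaluations at nonzero numbers.

Conversely, a tensor product of two-dimensional evaluation representations contains a highest weight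
vector of weight `φ`, and `V φ` is a subquotient of it (`finiteDimensional_V`).

The first direction also needs `v ≠ 0` in `V φ`. An explicit Verma module on polynomials shows `M(φ)
≠ 0`, and a weight argument shows that the sum of the proper submodules is proper. -/

/-! ### Representations of current algebras of `sl₂` -/

/-- A representation of `A ⊗ sl₂` on `M`, given by the operators of `a ⊗ e`, `a ⊗ f`, `a ⊗ h`. -/
structure CurrentRep (A M : Type*) [CommRing A] [Algebra ℂ A] [AddCommGroup M] [Module ℂ M] where
  E : A →ₗ[ℂ] Module.End ℂ M
  F : A →ₗ[ℂ] Module.End ℂ M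
  H : A →ₗ[ℂ] Module.End ℂ M
  E_F : ∀ a b m, E a (F b m) = F b (E a m) + H (a * b) m
  H_E : ∀ a b m, H a (E b m) = E b (H a m) + (2 : ℂ) • E (a * b) m
  H_F : ∀ a b m, H a (F b m) = F b (H a m) - (2 : ℂ) • F (a * b) m
  E_E : ∀ a b m, E a (E b m) = E b (E a m)
  F_F : ∀ a b m, F a (F b m) = F b (F a m)
  H_H : ∀ a b m, H a (H b m) = H b (H a m)

namespace CurrentRep

variable {A M : Type*} [CommRing A] [Algebra ℂ A] [AddCommGroup M] [Module ℂ M]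
  (ρ : CurrentRep A M)

/-- A subspace which is stable under all the operators of a representation. -/
structure IsStable (N : Submodule ℂ M) : Prop where
  E_mem : ∀ a, ∀ m ∈ N, ρ.E a m ∈ N
  F_mem : ∀ a, ∀ m ∈ N, ρ.F a m ∈ N
  H_mem : ∀ a, ∀ m ∈ N, ρ.H a m ∈ N

/-- The span of the vectors `F a₁ ⋯ F aₖ s` with `s ∈ S`. -/
def lower (S : Submodule ℂ M) : ℕ → Submodule ℂ M
  | 0 => S
  | k + 1 => ⨆ a, (lower S k).map (ρ.F a)

variable {ρ} {S : Submodule ℂ M}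

theorem F_mem_lower {k : ℕ} (a : A) {m : M} (hm : m ∈ ρ.lower S k) :
    ρ.F a m ∈ ρ.lower S (k + 1) :=
  Submodule.mem_iSup_of_mem a (Submodule.mem_map_of_mem hm)

theorem lower_succ_le {k : ℕ} {N : Submodule ℂ M}
    (hN : ∀ a, ∀ m ∈ ρ.lower S k, ρ.F a m ∈ N) : ρ.lower S (k + 1) ≤ N :=
  iSup_le fun a => Submodule.map_le_iff_le_comap.2 (hN a)

theorem H_mem_lower (hH : ∀ b, ∀ s ∈ S, ρ.H b s ∈ S) (k : ℕ) :
    ∀ b, ∀ m ∈ ρ.lower S k, ρ.H b m ∈ ρ.lower S k := by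
  induction k with
  | zero => exact hH
  | succ k ih =>
    intro b
    refine lower_succ_le (N := (ρ.lower S (k + 1)).comap (ρ.H b)) fun a m hm => ?_
    rw [Submodule.mem_comap, ρ.H_F]
    exact sub_mem (F_mem_lower _ (ih b m hm)) (Submodule.smul_mem _ _ (F_mem_lower _ hm))

theorem E_mem_lower (hH : ∀ b, ∀ s ∈ S, ρ.H b s ∈ S) (hE : ∀ b, ∀ s ∈ S, ρ.E b s = 0) (k : ℕ) :
    ∀ b, ∀ m ∈ ρ.lower S (k + 1), ρ.E b m ∈ ρ.lower S k := by
  induction k with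
  | zero =>
    intro b
    refine lower_succ_le (N := S.comap (ρ.E b)) fun a m hm => ?_
    rw [Submodule.mem_comap, ρ.E_F, hE b m hm, map_zero, zero_add]
    exact hH _ _ hm
  | succ k ih =>
    intro b
    refine lower_succ_le (N := (ρ.lower S (k + 1)).comap (ρ.E b)) fun a m hm => ?_
    rw [Submodule.mem_comap, ρ.E_F]
    exact add_mem (F_mem_lower _ (ih b m hm)) (H_mem_lower hH _ _ _ hm)

/-- Operators `E` and `H` can be commuted to the right past the `F`s until they meet `S`: `F` raises
the index of `lower` by one, `H` preserves it, and `E` lowers it by one or kills `S`. -/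
theorem isStable_iSup_lower (hH : ∀ b, ∀ s ∈ S, ρ.H b s ∈ S) (hE : ∀ b, ∀ s ∈ S, ρ.E b s = 0) :
    ρ.IsStable (⨆ k, ρ.lower S k) := by
  refine ⟨fun b => ?_, fun b => ?_, fun b => ?_⟩
  · have : ⨆ k, ρ.lower S k ≤ (⨆ k, ρ.lower S k).comap (ρ.E b) := iSup_le fun k m hm => by
      rw [Submodule.mem_comap]
      cases k with
      | zero => rw [hE b m hm]; exact zero_mem _
      | succ k => exact Submodule.mem_iSup_of_mem k (E_mem_lower hH hE k b m hm)
    exact this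
  · have : ⨆ k, ρ.lower S k ≤ (⨆ k, ρ.lower S k).comap (ρ.F b) := iSup_le fun k m hm =>
      Submodule.mem_iSup_of_mem (p := ρ.lower S) (k + 1) (F_mem_lower b hm)
    exact this
  · have : ⨆ k, ρ.lower S k ≤ (⨆ k, ρ.lower S k).comap (ρ.H b) := iSup_le fun k m hm =>
      Submodule.mem_iSup_of_mem (p := ρ.lower S) k (H_mem_lower hH k b m hm)
    exact this

theorem lower_le_eigenspace {μ : ℂ} (hS : S ≤ (ρ.H 1).eigenspace μ) (k : ℕ) :
    ρ.lower S k ≤ (ρ.H 1).eigenspace (μ - 2 * k) := by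
  induction k with
  | zero => simpa [lower] using hS
  | succ k ih =>
    refine lower_succ_le fun a m hm => ?_
    have := Module.End.mem_eigenspace_iff.1 (ih hm)
    rw [Module.End.mem_eigenspace_iff, ρ.H_F, this, one_mul, map_smul, ← sub_smul]
    congr 1
    push_cast
    ring

/-! ### Weight spaces and highest weight vectors -/

variable (ρ) in
/-- `v` is a highest weight vector of weight `φ`. -/
structure IsHighest (φ : A →ₗ[ℂ] ℂ) (v : M) : Prop where
  E_eq : ∀ a, ρ.E a v = 0
  H_eq : ∀ a, ρ.H a v = φ a • v

variable (ρ) in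
/-- The sum of the `H 1`-eigenspaces for eigenvalues other than `μ`. -/
def otherWeights (μ : ℂ) : Submodule ℂ M :=
  ⨆ (ν) (_ : ν ≠ μ), (ρ.H 1).eigenspace ν

theorem eigenspace_le_otherWeights {μ ν : ℂ} (h : ν ≠ μ) :
    (ρ.H 1).eigenspace ν ≤ ρ.otherWeights μ :=
  le_iSup₂_of_le ν h le_rfl

theorem disjoint_otherWeights (μ : ℂ) :
    Disjoint ((ρ.H 1).eigenspace μ) (ρ.otherWeights μ) :=
  (ρ.H 1).eigenspaces_iSupIndep μ

theorem exists_aeval_eq_zero {μ : ℂ} {y : M} (hy : y ∈ ρ.otherWeights μ) :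
    ∃ p : Polynomial ℂ, p.eval μ ≠ 0 ∧ Polynomial.aeval (ρ.H 1) p y = 0 := by
  unfold otherWeights at hy
  rw [iSup_subtype'] at hy
  induction hy using Submodule.iSup_induction' with
  | mem ν y hy =>
    refine ⟨Polynomial.X - Polynomial.C ν.1, ?_, ?_⟩
    · simpa [sub_eq_zero] using ν.2.symm
    · simpa [sub_eq_zero] using Module.End.mem_eigenspace_iff.1 hy
  | zero => exact ⟨1, by simp, by simp⟩
  | add x y _ _ hx hy =>
    obtain ⟨p, hp0, hp⟩ := hx
    obtain ⟨q, hq0, hq⟩ := hy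
    refine ⟨p * q, by simp [hp0, hq0], ?_⟩
    rw [map_add, map_mul, Module.End.mul_apply, Module.End.mul_apply, hq, map_zero, add_zero,
      ← Module.End.mul_apply, ← map_mul, mul_comm, map_mul, Module.End.mul_apply, hp, map_zero]

theorem aeval_mem_of_forall_mem {g : Module.End ℂ M} {N : Submodule ℂ M}
    (hN : ∀ m ∈ N, g m ∈ N) (p : Polynomial ℂ) {m : M} (hm : m ∈ N) :
    Polynomial.aeval g p m ∈ N := by
  induction p using Polynomial.induction_on generalizing m with
  | C a => simpa using N.smul_mem a hm
  | add p q hp hq => simpa using add_mem (hp hm) (hq hm)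
  | monomial n a ih =>
    rw [pow_succ, ← mul_assoc, map_mul, Module.End.mul_apply]
    exact ih (by simpa using hN m hm)

namespace IsHighest

variable {φ : A →ₗ[ℂ] ℂ} {v : M} (hv : ρ.IsHighest φ v)
include hv

theorem mem_eigenspace : v ∈ (ρ.H 1).eigenspace (φ 1) :=
  Module.End.mem_eigenspace_iff.2 (hv.H_eq 1)

theorem notMem_otherWeights (h0 : v ≠ 0) : v ∉ ρ.otherWeights (φ 1) := fun h =>
  h0 (Submodule.disjoint_def.1 (disjoint_otherWeights (φ 1)) v hv.mem_eigenspace h)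

theorem iSup_lower_eq_top (hgen : ∀ N, ρ.IsStable N → v ∈ N → N = ⊤) :
    ⨆ k, ρ.lower (ℂ ∙ v) k = ⊤ := by
  refine hgen _ (isStable_iSup_lower ?_ ?_) ?_
  · intro b s hs
    obtain ⟨c, rfl⟩ := Submodule.mem_span_singleton.1 hs
    rw [map_smul, hv.H_eq]
    exact Submodule.smul_mem _ _ (Submodule.smul_mem _ _ (Submodule.mem_span_singleton_self v))
  · intro b s hs
    obtain ⟨c, rfl⟩ := Submodule.mem_span_singleton.1 hs
    rw [map_smul, hv.E_eq, smul_zero]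
  · exact Submodule.mem_iSup_of_mem 0 (Submodule.mem_span_singleton_self v)

theorem lower_le (k : ℕ) :
    ρ.lower (ℂ ∙ v) k ≤ (ρ.H 1).eigenspace (φ 1 - 2 * k) :=
  lower_le_eigenspace ((Submodule.span_singleton_le_iff_mem _ _).2 hv.mem_eigenspace) k

/-- Words with `k` factors `F` have weight `φ 1 - 2 * k`, which equals `φ 1` only for `k = 0`. -/
theorem span_sup_otherWeights (hgen : ∀ N, ρ.IsStable N → v ∈ N → N = ⊤) :
    (ℂ ∙ v) ⊔ ρ.otherWeights (φ 1) = ⊤ := by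
  rw [eq_top_iff, ← hv.iSup_lower_eq_top hgen]
  refine iSup_le fun k => ?_
  cases k with
  | zero => exact le_sup_left
  | succ k =>
    refine le_sup_of_le_right ((hv.lower_le _).trans (eigenspace_le_otherWeights ?_))
    intro h
    have : (2 : ℂ) * ((k + 1 : ℕ) : ℂ) = 0 := by linear_combination -h
    simp [Nat.cast_add_one_ne_zero] at this

/-- Write `m = c • v + y` with `y` in the other weights. A polynomial in `H 1` that kills `y` but
not `v` sends `m` to a nonzero multiple of `c • v`, which stays in `N`; hence `c = 0`. -/
theorem le_otherWeights (hgen : ∀ N, ρ.IsStable N → v ∈ N → N = ⊤) {N : Submodule ℂ M}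
    (hN : ρ.IsStable N) (hvN : v ∉ N) : N ≤ ρ.otherWeights (φ 1) := by
  intro m hm
  obtain ⟨x, hx, y, hy, rfl⟩ :=
    Submodule.mem_sup.1 (hv.span_sup_otherWeights hgen ▸ Submodule.mem_top : m ∈ _)
  obtain ⟨c, rfl⟩ := Submodule.mem_span_singleton.1 hx
  obtain ⟨p, hp0, hp⟩ := exists_aeval_eq_zero hy
  have h := aeval_mem_of_forall_mem (hN.H_mem 1) p hm
  have hpv : Polynomial.aeval (ρ.H 1) p v = p.eval (φ 1) • v := by
    by_cases h0 : v = 0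
    · simp [h0]
    · exact Module.End.aeval_apply_of_hasEigenvector ⟨hv.mem_eigenspace, h0⟩
  rw [map_add, hp, add_zero, map_smul, hpv, smul_smul] at h
  by_cases hc : c = 0
  · simpa [hc] using hy
  · exact absurd ((N.smul_mem_iff (mul_ne_zero hc hp0)).1 h) hvN

/-- The vectors `F a v` with such `a` are killed by every `E b` and permuted among themselves by
every `H b`. They generate a stable subspace whose weights are `φ 1 - 2 * (k + 1)`, so it misses `v`
and must vanish. -/
theorem F_eq_zero_of_simple (h0 : v ≠ 0) (hsimple : ∀ N, ρ.IsStable N → v ∉ N → N = ⊥)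
    {a : A} (ha : ∀ b, φ (b * a) = 0) : ρ.F a v = 0 := by
  let I : Submodule ℂ A :=
    { carrier := {a | ∀ b, φ (b * a) = 0}
      add_mem' := fun {x y} hx hy b => by rw [mul_add, map_add, hx b, hy b, add_zero]
      zero_mem' := fun b => by simp
      smul_mem' := fun c x hx b => by rw [mul_smul_comm, map_smul, hx b, smul_zero] }
  let S : Submodule ℂ M := I.map (ρ.F.flip v)
  have hH : ∀ b, ∀ s ∈ S, ρ.H b s ∈ S := by
    rintro b _ ⟨x, hx, rfl⟩
    rw [LinearMap.flip_apply, ρ.H_F, hv.H_eq, map_smul]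
    refine sub_mem (S.smul_mem _ ⟨x, hx, rfl⟩) (S.smul_mem _ ⟨b * x, fun c => ?_, rfl⟩)
    rw [← mul_assoc]
    exact hx _
  have hE : ∀ b, ∀ s ∈ S, ρ.E b s = 0 := by
    rintro b _ ⟨x, hx, rfl⟩
    rw [LinearMap.flip_apply, ρ.E_F, hv.E_eq, map_zero, zero_add, hv.H_eq, hx b, zero_smul]
  have hS : S ≤ (ρ.H 1).eigenspace (φ 1 - 2) := by
    rintro _ ⟨x, hx, rfl⟩
    rw [Module.End.mem_eigenspace_iff, LinearMap.flip_apply, ρ.H_F, hv.H_eq, map_smul, one_mul,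
      sub_smul]
  have hbot := hsimple _ (isStable_iSup_lower hH hE) fun hmem => by
    have hle : ⨆ k, ρ.lower S k ≤ ρ.otherWeights (φ 1) := iSup_le fun k => ?_
    · exact hv.notMem_otherWeights h0 (hle hmem)
    refine (lower_le_eigenspace hS k).trans (eigenspace_le_otherWeights fun h => ?_)
    have : (2 : ℂ) * ((k + 1 : ℕ) : ℂ) = 0 := by push_cast; linear_combination -h
    simp [Nat.cast_add_one_ne_zero] at this
  have : ρ.F a v ∈ ⨆ k, ρ.lower S k := Submodule.mem_iSup_of_mem 0 ⟨a, ha, rfl⟩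
  rwa [hbot, Submodule.mem_bot] at this

theorem H_pow_F {a : A} {s : ℂ} (ha : ρ.F (a * a) v = s • ρ.F a v) (j : ℕ) :
    ρ.H a ((ρ.F a ^ j) v) = (φ a - 2 * s * j) • (ρ.F a ^ j) v := by
  have hc : ∀ j, ρ.F (a * a) ((ρ.F a ^ j) v) = s • (ρ.F a ^ (j + 1)) v := by
    intro j
    induction j with
    | zero => simpa using ha
    | succ j ih =>
      rw [pow_succ', Module.End.mul_apply, ρ.F_F, ih, map_smul, ← Module.End.mul_apply, ← pow_succ']
  induction j with
  | zero => simp [hv.H_eq]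
  | succ j ih =>
    rw [pow_succ', Module.End.mul_apply, ρ.H_F, ih, hc, map_smul, pow_succ', Module.End.mul_apply,
      smul_smul, ← sub_smul]
    congr 1
    push_cast
    ring

/-- This is the usual `sl₂` formula for `e f^(j+1) v`. The hypothesis on `a * a` is what keeps `H a`
acting by scalars on the powers of `F a`; the case `s = 1` imitates an idempotent and `s = 0` a
square-zero element. -/
theorem E_pow_F {a : A} {s : ℂ} (ha : ρ.F (a * a) v = s • ρ.F a v) (j : ℕ) :
    ρ.E 1 ((ρ.F a ^ (j + 1)) v) = ((j + 1) * (φ a - s * j)) • (ρ.F a ^ j) v := by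
  induction j with
  | zero => simp [ρ.E_F, hv.E_eq, hv.H_eq]
  | succ j ih =>
    rw [pow_succ', Module.End.mul_apply, ρ.E_F, ih, one_mul, hv.H_pow_F ha, map_smul,
      ← Module.End.mul_apply, ← pow_succ', ← add_smul]
    congr 1
    push_cast
    ring

/-- Nonzero powers would be eigenvectors of `H 1` for infinitely many distinct eigenvalues. -/
theorem exists_pow_F_eq_zero [FiniteDimensional ℂ M] (a : A) : ∃ j, (ρ.F a ^ j) v = 0 := by
  by_contra! hne
  have hw : ∀ j : ℕ, (ρ.H 1).HasEigenvector (φ 1 - 2 * j) ((ρ.F a ^ j) v) := by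
    intro j
    refine ⟨?_, hne j⟩
    induction j with
    | zero => simpa using hv.mem_eigenspace
    | succ j ih =>
      rw [Module.End.mem_eigenspace_iff] at ih ⊢
      rw [pow_succ', Module.End.mul_apply, ρ.H_F, ih, one_mul, map_smul, ← sub_smul]
      congr 1
      push_cast
      ring
  have hli := Module.End.eigenvectors_linearIndependent' (ρ.H 1) (fun j : ℕ => φ 1 - 2 * (j : ℂ))
    (fun i j hij => by simpa using hij) _ hw
  exact not_finite_iff_infinite.2 inferInstance (LinearIndependent.finite_of_isNoetherian hli)

theorem exists_eq_mul_nat [FiniteDimensional ℂ M] (h0 : v ≠ 0) {a : A} {s : ℂ}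
    (ha : ρ.F (a * a) v = s • ρ.F a v) : ∃ n : ℕ, φ a = s * n := by
  classical
  have hex := hv.exists_pow_F_eq_zero a
  obtain ⟨j, hj⟩ : ∃ j, Nat.find hex = j + 1 :=
    Nat.exists_eq_succ_of_ne_zero fun h => h0 (by simpa [h] using Nat.find_spec hex)
  -- As `j + 1` is the least exponent that kills `v`, the left side vanishes while the vector on the
  -- right does not, so the coefficient is zero.
  have h1 := hv.E_pow_F ha j
  rw [← hj, Nat.find_spec hex, map_zero, eq_comm, smul_eq_zero, mul_eq_zero] at h1
  have h2 := Nat.find_min hex (m := j) (by omega)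
  refine ⟨j, ?_⟩
  rcases h1 with (h1 | h1) | h1
  · exact absurd h1 (Nat.cast_add_one_ne_zero j)
  · exact sub_eq_zero.1 h1
  · exact absurd h1 h2

end IsHighest

end CurrentRep

/-! ### Highest weights of finite-dimensional simple representations -/

/-- A finite-dimensional reduced commutative algebra over `ℂ` has a basis of idempotents,
whose coordinates are algebra homomorphisms. -/
theorem exists_idempotent_basis (B : Type*) [CommRing B] [Algebra ℂ B] [FiniteDimensional ℂ B]
    [IsReduced B] : ∃ (k : ℕ) (χ : Fin k → B →ₐ[ℂ] ℂ) (ε : Fin k → B),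
      (∀ i, ε i * ε i = ε i) ∧ ∀ b, b = ∑ i, χ i b • ε i := by
  classical
  have : IsArtinianRing B := IsArtinianRing.of_finite ℂ B
  have : Fintype (MaximalSpectrum B) := Fintype.ofFinite _
  let q := fun m : MaximalSpectrum B => Ideal.Quotient.field m.asIdeal
  -- Each residue field is finite over the algebraically closed field `ℂ`, hence equal to it; a
  -- reduced Artinian ring is the product of its residue fields.
  let r := fun m : MaximalSpectrum B =>
    AlgEquiv.ofBijective (Algebra.ofId ℂ (B ⧸ m.asIdeal))
      IsAlgClosed.algebraMap_bijective_of_isIntegral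
  let σ := (Fintype.equivFin (MaximalSpectrum B)).symm
  refine ⟨_, fun i => (r (σ i)).symm.toAlgHom.comp (Ideal.Quotient.mkₐ ℂ _),
    fun i => (IsArtinianRing.equivPi B).symm (Pi.single (σ i) 1), fun i => ?_, fun b => ?_⟩
  · rw [← map_mul, ← Pi.single_mul, one_mul]
  · rw [Equiv.sum_comp σ fun m =>
      ((r m).symm.toAlgHom.comp (Ideal.Quotient.mkₐ ℂ m.asIdeal)) b •
        (IsArtinianRing.equivPi B).symm (Pi.single m 1)]
    apply (IsArtinianRing.equivPi B).injective
    rw [map_sum]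
    ext m
    rw [Finset.sum_apply, Finset.sum_eq_single m]
    · rw [Algebra.smul_def, map_mul, AlgEquiv.apply_symm_apply, Pi.mul_apply, Pi.single_eq_same,
        mul_one, IsArtinianRing.equivPi_apply, IsArtinianRing.equivPi_apply]
      exact ((r m).apply_symm_apply _).symm
    · intro m' _ hm'
      rw [Algebra.smul_def, map_mul, AlgEquiv.apply_symm_apply, Pi.mul_apply,
        Pi.single_eq_of_ne hm'.symm, mul_zero]
    · simp

namespace CurrentRep

theorem IsHighest.exists_eq_sum {A M : Type*} [CommRing A] [Algebra ℂ A] [AddCommGroup M]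
    [Module ℂ M] [FiniteDimensional ℂ M] {ρ : CurrentRep A M} {φ : A →ₗ[ℂ] ℂ} {v : M}
    (hv : ρ.IsHighest φ v) (h0 : v ≠ 0) (hsimple : ∀ N, ρ.IsStable N → v ∉ N → N = ⊥) :
    ∃ (n : ℕ) (χ : Fin n → A →ₐ[ℂ] ℂ), ∀ a, φ a = ∑ i, χ i a := by
  let I : Ideal A :=
    { carrier := {a | ∀ b, φ (b * a) = 0}
      add_mem' := fun {x y} hx hy b => by rw [mul_add, map_add, hx b, hy b, add_zero]
      zero_mem' := fun b => by simp
      smul_mem' := fun c x hx b => by rw [smul_eq_mul, ← mul_assoc]; exact hx _ }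
  have hF : ∀ a ∈ I, ρ.F a v = 0 := fun a ha => hv.F_eq_zero_of_simple h0 hsimple ha
  -- Applying `E b` to `F a v` reads off `φ (b * a)`, which gives the inclusion opposite to `hF`. So
  -- `A ⧸ I` embeds into `M`.
  have hker : LinearMap.ker (ρ.F.flip v) = I.restrictScalars ℂ := by
    ext a
    refine ⟨fun ha b => ?_, hF a⟩
    have h : ρ.E b (ρ.F a v) = φ (b * a) • v := by
      rw [ρ.E_F, hv.E_eq, map_zero, zero_add, hv.H_eq]
    rw [LinearMap.mem_ker, LinearMap.flip_apply] at ha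
    rw [ha, map_zero, eq_comm, smul_eq_zero] at h
    exact h.resolve_right h0
  have hfin : FiniteDimensional ℂ (A ⧸ I) := by
    have h1 := (ρ.F.flip v).quotKerEquivRange.symm.finiteDimensional
    rw [hker] at h1
    exact (Submodule.Quotient.restrictScalarsEquiv ℂ I).finiteDimensional
  have hred : IsReduced (A ⧸ I) := by
    rw [← Ideal.isRadical_iff_quotient_reduced, Ideal.isRadical_iff_pow_one_lt 2 one_lt_two]
    intro a ha b
    have hmem : b * a * (b * a) ∈ I := by
      have : b * a * (b * a) = b ^ 2 * a ^ 2 := by ring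
      exact this ▸ I.mul_mem_left _ ha
    -- With `s = 0` the conclusion reads `φ (b * a) = 0 * n`.
    obtain ⟨n, hn⟩ := hv.exists_eq_mul_nat h0 (a := b * a) (s := 0) (by rw [hF _ hmem, zero_smul])
    rw [hn, zero_mul]
  obtain ⟨k, χ, ε, hε, hsum⟩ := exists_idempotent_basis (A ⧸ I)
  choose c hc using fun i => Ideal.Quotient.mk_surjective (ε i)
  have hnat : ∀ i, ∃ n : ℕ, φ (c i) = n := by
    intro i
    -- The lift `c i` is idempotent only modulo `I`, but elements of `I` act on `v` by zero through
    -- `F`, so the case `s = 1` still applies.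
    have hmem : c i * c i - c i ∈ I := by
      rw [← Ideal.Quotient.eq_zero_iff_mem, map_sub, map_mul, hc, hε, sub_self]
    have := hF _ hmem
    rw [map_sub, LinearMap.sub_apply, sub_eq_zero] at this
    simpa using hv.exists_eq_mul_nat h0 (a := c i) (s := 1) (by rw [this, one_smul])
  choose n hn using hnat
  have key : ∀ a, φ a = ∑ i, n i * χ i (Ideal.Quotient.mk I a) := by
    intro a
    have hmem : a - ∑ i, χ i (Ideal.Quotient.mk I a) • c i ∈ I := by
      rw [← Ideal.Quotient.eq_zero_iff_mem, map_sub, map_sum, sub_eq_zero]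
      conv_lhs => rw [hsum (Ideal.Quotient.mk I a)]
      refine Finset.sum_congr rfl fun i _ => ?_
      rw [← hc i]
      rfl
    have := hmem 1
    rw [one_mul, map_sub, sub_eq_zero, map_sum] at this
    rw [this]
    exact Finset.sum_congr rfl fun i _ => by rw [map_smul, hn, smul_eq_mul, mul_comm]
  -- The multiplicities are absorbed by listing the character `χ i` exactly `n i` times.
  refine ⟨∑ i, n i, fun i => (χ (finSigmaFinEquiv (n := n).symm i).1).comp (Ideal.Quotient.mkₐ ℂ I), fun a => ?_⟩
  rw [key, Equiv.sum_comp finSigmaFinEquiv.symm fun x : (i : Fin k) × Fin (n i) =>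
    ((χ x.1).comp (Ideal.Quotient.mkₐ ℂ I)) a, Fintype.sum_sigma]
  simp

/-! ### Tensor products of evaluation representations -/

/-- The tensor product of a representation with the two-dimensional evaluation representation
at a character `χ`; a pair `(x, y)` stands for `x ⊗ v₊ + y ⊗ v₋`. -/
def prodEval {A M : Type*} [CommRing A] [Algebra ℂ A] [AddCommGroup M] [Module ℂ M]
    (ρ : CurrentRep A M) (χ : A →ₐ[ℂ] ℂ) : CurrentRep A (M × M) where
  E := LinearMap.mk₂ ℂ (fun a m => (ρ.E a m.1 + χ a • m.2, ρ.E a m.2))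
    (fun a b m => by ext <;> simp; module) (fun c a m => by ext <;> simp; module)
    (fun a m m' => by ext <;> simp; module) (fun c a m => by ext <;> simp; module)
  F := LinearMap.mk₂ ℂ (fun a m => (ρ.F a m.1, ρ.F a m.2 + χ a • m.1))
    (fun a b m => by ext <;> simp; module) (fun c a m => by ext <;> simp; module)
    (fun a m m' => by ext <;> simp; module) (fun c a m => by ext <;> simp; module)
  H := LinearMap.mk₂ ℂ (fun a m => (ρ.H a m.1 + χ a • m.1, ρ.H a m.2 - χ a • m.2))
    (fun a b m => by ext <;> simp <;> module) (fun c a m => by ext <;> simp <;> module)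
    (fun a m m' => by ext <;> simp <;> module) (fun c a m => by ext <;> simp <;> module)
  E_F a b m := by ext <;> simp [ρ.E_F] <;> module
  H_E a b m := by ext <;> (simp [ρ.H_E]; module)
  H_F a b m := by ext <;> (simp [ρ.H_F]; module)
  E_E a b m := by ext <;> simp [ρ.E_E a b]; module
  F_F a b m := by ext <;> simp [ρ.F_F a b]; module
  H_H a b m := by ext <;> simp [ρ.H_H a b] <;> module

/-- Start from the trivial representation and tensor with one evaluation representation at a time;
`(v, 0)` is `v ⊗ v₊`, so each step adds one character to the weight. -/
theorem exists_finiteDimensional {A : Type*} [CommRing A] [Algebra ℂ A] (n : ℕ)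
    (χ : Fin n → A →ₐ[ℂ] ℂ) :
    ∃ (M : Type) (_ : AddCommGroup M) (_ : Module ℂ M) (_ : FiniteDimensional ℂ M)
      (ρ : CurrentRep A M) (v : M), v ≠ 0 ∧ ρ.IsHighest (∑ i, (χ i).toLinearMap) v := by
  induction n with
  | zero =>
    exact ⟨ℂ, inferInstance, inferInstance, inferInstance,
      ⟨0, 0, 0, by simp, by simp, by simp, by simp, by simp, by simp⟩, 1, one_ne_zero,
      by simp, by simp⟩
  | succ n ih =>
    obtain ⟨M, _, _, _, ρ, v, h0, hv⟩ := ih fun i => χ i.castSucc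
    refine ⟨M × M, inferInstance, inferInstance, inferInstance, ρ.prodEval (χ (Fin.last n)),
      (v, 0), by simpa using h0, fun a => ?_, fun a => ?_⟩
    · simp [prodEval, hv.E_eq]
    · simp [prodEval, hv.H_eq, Fin.sum_univ_castSucc, add_smul]

end CurrentRep

/-! ### The Verma module of the loop algebra of `sl₂` -/

namespace Verma

open MvPolynomial

/-- The derivation `X m ↦ X (n + m)`. -/
def shift (n : ℤ) : Derivation ℂ (MvPolynomial ℤ ℂ) (MvPolynomial ℤ ℂ) :=
  mkDerivation ℂ fun m => X (n + m)

/-- The total differential. -/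
def grad : Derivation ℂ (MvPolynomial ℤ ℂ) (ℤ →₀ MvPolynomial ℤ ℂ) :=
  mkDerivation ℂ fun m => Finsupp.single m 1

variable (φ : ℤ → ℂ)

/-- The action of `tⁿ ⊗ f`. -/
def opF (n : ℤ) : Module.End ℂ (MvPolynomial ℤ ℂ) := LinearMap.mulLeft ℂ (X n)

/-- The action of `tⁿ ⊗ h`. -/
def opH (n : ℤ) : Module.End ℂ (MvPolynomial ℤ ℂ) :=
  φ n • LinearMap.id - (2 : ℂ) • (shift n).toLinearMap

/-- The map with `opE φ n = contract φ n ∘ grad`. -/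
def contract (n : ℤ) : (ℤ →₀ MvPolynomial ℤ ℂ) →ₗ[ℂ] MvPolynomial ℤ ℂ :=
  Finsupp.lsum ℂ fun b => φ (n + b) • LinearMap.id - (shift (n + b)).toLinearMap

/-- The action of `tⁿ ⊗ e`. -/
def opE (n : ℤ) : Module.End ℂ (MvPolynomial ℤ ℂ) := contract φ n ∘ₗ grad.toLinearMap

theorem opF_apply (n : ℤ) (p : MvPolynomial ℤ ℂ) : opF n p = X n * p := rfl

theorem opH_apply (n : ℤ) (p : MvPolynomial ℤ ℂ) : opH φ n p = φ n • p - (2 : ℂ) • shift n p := rfl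

theorem opE_apply (n : ℤ) (p : MvPolynomial ℤ ℂ) : opE φ n p = contract φ n (grad p) := rfl

theorem shift_X (n m : ℤ) : shift n (X m) = X (n + m) := mkDerivation_X ..

theorem grad_X (m : ℤ) : grad (X m) = Finsupp.single m 1 := mkDerivation_X ..

theorem contract_single (n b : ℤ) (p : MvPolynomial ℤ ℂ) :
    contract φ n (Finsupp.single b p) = φ (n + b) • p - shift (n + b) p := by
  simp [contract]

/-- An operator which commutes with multiplications by variables and kills `1` is zero. -/
theorem eq_zero_of_commute {K : Module.End ℂ (MvPolynomial ℤ ℂ)} (h1 : K 1 = 0)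
    (hX : ∀ n p, K (X n * p) = X n * K p) : K = 0 := by
  refine LinearMap.ext fun p => ?_
  induction p using MvPolynomial.induction_on with
  | C a => rw [← mul_one (C a), ← smul_eq_C_mul, map_smul, h1, smul_zero, LinearMap.zero_apply]
  | add p q hp hq => rw [map_add, hp, hq, map_add]
  | mul_X p n hp => rw [mul_comm, hX, hp, LinearMap.zero_apply, mul_zero, LinearMap.zero_apply]

theorem opH_mul (n m : ℤ) (p : MvPolynomial ℤ ℂ) :
    opH φ n (X m * p) = X m * opH φ n p - (2 : ℂ) • (X (n + m) * p) := by
  simp only [opH_apply, Derivation.leibniz, shift_X, smul_eq_mul, mul_sub, mul_smul_comm, smul_add,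
    mul_comm p]
  module

/-- The correction term is the Leibniz contribution of `shift (n + b)` acting on `X m`. -/
theorem contract_smul (n m : ℤ) (q : ℤ →₀ MvPolynomial ℤ ℂ) :
    contract φ n ((X m : MvPolynomial ℤ ℂ) • q) = X m * contract φ n q - Finsupp.sum q fun b (p : MvPolynomial ℤ ℂ) => X (n + m + b) * p := by
  induction q using Finsupp.induction_linear with
  | zero => simp
  | add q r hq hr =>
    rw [smul_add, map_add, hq, hr, map_add, Finsupp.sum_add_index' (by simp) (by simp [mul_add])]
    ring
  | single b p =>
    rw [Finsupp.smul_single, contract_single, contract_single, smul_eq_mul, Derivation.leibniz,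
      shift_X, Finsupp.sum_single_index (by simp)]
    simp only [smul_eq_mul, mul_sub, mul_smul_comm, mul_comm p, add_right_comm n m b,
      add_assoc n b m]
    rw [add_comm b m, ← add_assoc, add_right_comm]
    abel

theorem sum_grad (n : ℤ) (p : MvPolynomial ℤ ℂ) :
    (Finsupp.sum (grad p) fun b q => X (n + b) * q) = shift n p := by
  let D : (ℤ →₀ MvPolynomial ℤ ℂ) →ₗ[MvPolynomial ℤ ℂ] MvPolynomial ℤ ℂ :=
    Finsupp.lsum ℂ fun b => LinearMap.mulLeft (MvPolynomial ℤ ℂ) (X (n + b))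
  have : D.compDer grad = shift n := MvPolynomial.derivation_ext fun m => by
    simp [D, grad_X, shift_X]
  exact DFunLike.congr_fun this p

/-- The term `shift (n + m) p` arises twice, once from differentiating `X m` and once from the
correction in `contract_smul`; this accounts for the factor `2` in `opH`. -/
theorem opE_mul (n m : ℤ) (p : MvPolynomial ℤ ℂ) :
    opE φ n (X m * p) = X m * opE φ n p + opH φ (n + m) p := by
  rw [opE_apply, Derivation.leibniz, grad_X, map_add, contract_smul, sum_grad, Finsupp.smul_single,
    smul_eq_mul, mul_one, contract_single, opH_apply, opE_apply]
  module

theorem opH_one (n : ℤ) : opH φ n 1 = φ n • 1 := by simp [opH_apply]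

theorem opE_one (n : ℤ) : opE φ n 1 = 0 := by simp [opE_apply]

/-- Here and in the next two relations, the defect of the relation kills `1` and commutes with
multiplication by variables, because the commutators with `opF` are already known. -/
theorem opH_opH (a b : ℤ) (p : MvPolynomial ℤ ℂ) :
    opH φ a (opH φ b p) = opH φ b (opH φ a p) := by
  have := eq_zero_of_commute (K := opH φ a * opH φ b - opH φ b * opH φ a) ?_ fun n p => ?_
  · exact sub_eq_zero.1 (DFunLike.congr_fun this p)
  · simp [opH_one, mul_comm, smul_smul]
  · simp only [LinearMap.sub_apply, Module.End.mul_apply, opH_mul, map_sub, map_smul, mul_sub,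
      ← add_assoc, add_comm a b]
    module

theorem opH_opE (a b : ℤ) (p : MvPolynomial ℤ ℂ) :
    opH φ a (opE φ b p) = opE φ b (opH φ a p) + (2 : ℂ) • opE φ (a + b) p := by
  have := eq_zero_of_commute
    (K := opH φ a * opE φ b - (opE φ b * opH φ a + (2 : ℂ) • opE φ (a + b))) ?_ fun n p => ?_
  · exact sub_eq_zero.1 (DFunLike.congr_fun this p)
  · simp [opH_one, opE_one]
  · simp only [LinearMap.sub_apply, LinearMap.add_apply, LinearMap.smul_apply,
      Module.End.mul_apply, opH_mul, opE_mul, map_sub, map_add, map_smul, mul_sub, mul_add,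
      mul_smul_comm, opH_opH φ a (b + n), ← add_assoc, add_comm b a]
    module

theorem opE_opE (a b : ℤ) (p : MvPolynomial ℤ ℂ) :
    opE φ a (opE φ b p) = opE φ b (opE φ a p) := by
  have := eq_zero_of_commute (K := opE φ a * opE φ b - opE φ b * opE φ a) ?_ fun n p => ?_
  · exact sub_eq_zero.1 (DFunLike.congr_fun this p)
  · simp [opE_one]
  · simp only [LinearMap.sub_apply, Module.End.mul_apply, opE_mul, map_add, mul_sub, opH_opE]
    rw [add_right_comm a n b, add_right_comm b n a, add_comm b a]
    module

end Verma

/-! ### Passage from powers of `T` to all Laurent polynomials -/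

/-- Laurent polynomials are spanned by the powers of `T`. -/
theorem laurent_induction {P : ℂ[T;T⁻¹] → Prop} (hT : ∀ n, P (LaurentPolynomial.T n))
    (hadd : ∀ a b, P a → P b → P (a + b)) (hsmul : ∀ (c : ℂ) a, P a → P (c • a)) (a : ℂ[T;T⁻¹]) :
    P a :=
  a.induction_on' hadd fun n c => by
    rw [← LaurentPolynomial.smul_eq_C_mul]
    exact hsmul c _ (hT n)

/-- The linear map on Laurent polynomials with prescribed values at the powers of `T`. -/
def laurentLift {N : Type*} [AddCommGroup N] [Module ℂ N] (g : ℤ → N) : ℂ[T;T⁻¹] →ₗ[ℂ] N :=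
  Finsupp.linearCombination ℂ g ∘ₗ (AddMonoidAlgebra.coeffLinearEquiv ℂ).toLinearMap

@[simp]
theorem laurentLift_T {N : Type*} [AddCommGroup N] [Module ℂ N] (g : ℤ → N) (n : ℤ) :
    laurentLift g (LaurentPolynomial.T n) = g n := by
  have : AddMonoidAlgebra.coeff (LaurentPolynomial.T n : ℂ[T;T⁻¹]) = Finsupp.single n 1 := rfl
  simp [laurentLift, this]

/-- The Verma module of the loop algebra of `sl₂`, on polynomials in the elements `tⁿ ⊗ f`. -/
def verma (φ : ℂ[T;T⁻¹] →ₗ[ℂ] ℂ) : CurrentRep ℂ[T;T⁻¹] (MvPolynomial ℤ ℂ) where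
  E := laurentLift (Verma.opE fun n => φ (LaurentPolynomial.T n))
  F := laurentLift Verma.opF
  H := laurentLift (Verma.opH fun n => φ (LaurentPolynomial.T n))
  E_F a b m := by
    induction a using laurent_induction with
    | hT n =>
      induction b using laurent_induction with
      | hT k => simp only [laurentLift_T, ← LaurentPolynomial.T_add, Verma.opF_apply, Verma.opE_mul]
      | hadd b b' hb hb' => simp only [map_add, mul_add, LinearMap.add_apply, hb, hb']; module
      | hsmul c b hb =>
        simp only [map_smul, mul_smul_comm, LinearMap.smul_apply, hb]; module
    | hadd a a' ha ha' => simp only [map_add, add_mul, LinearMap.add_apply, ha, ha']; module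
    | hsmul c a ha => simp only [map_smul, smul_mul_assoc, LinearMap.smul_apply, ha]; module
  H_E a b m := by
    induction a using laurent_induction with
    | hT n =>
      induction b using laurent_induction with
      | hT k => simp only [laurentLift_T, ← LaurentPolynomial.T_add, Verma.opH_opE]
      | hadd b b' hb hb' => simp only [map_add, mul_add, LinearMap.add_apply, hb, hb']; module
      | hsmul c b hb =>
        simp only [map_smul, mul_smul_comm, LinearMap.smul_apply, hb]; module
    | hadd a a' ha ha' => simp only [map_add, add_mul, LinearMap.add_apply, ha, ha']; module
    | hsmul c a ha => simp only [map_smul, smul_mul_assoc, LinearMap.smul_apply, ha]; module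
  H_F a b m := by
    induction a using laurent_induction with
    | hT n =>
      induction b using laurent_induction with
      | hT k => simp only [laurentLift_T, ← LaurentPolynomial.T_add, Verma.opF_apply, Verma.opH_mul]
      | hadd b b' hb hb' => simp only [map_add, mul_add, LinearMap.add_apply, hb, hb']; module
      | hsmul c b hb =>
        simp only [map_smul, mul_smul_comm, LinearMap.smul_apply, hb]; module
    | hadd a a' ha ha' => simp only [map_add, add_mul, LinearMap.add_apply, ha, ha']; module
    | hsmul c a ha => simp only [map_smul, smul_mul_assoc, LinearMap.smul_apply, ha]; module
  E_E a b m := by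
    induction a using laurent_induction with
    | hT n =>
      induction b using laurent_induction with
      | hT k => simp [Verma.opE_opE _ n k]
      | hadd b b' hb hb' => simp only [map_add, LinearMap.add_apply, hb, hb']
      | hsmul c b hb => simp only [map_smul, LinearMap.smul_apply, hb]
    | hadd a a' ha ha' => simp only [map_add, LinearMap.add_apply, ha, ha']
    | hsmul c a ha => simp only [map_smul, LinearMap.smul_apply, ha]
  F_F a b m := by
    induction a using laurent_induction with
    | hT n =>
      induction b using laurent_induction with
      | hT k => simp [Verma.opF_apply, mul_left_comm]
      | hadd b b' hb hb' => simp only [map_add, LinearMap.add_apply, hb, hb']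
      | hsmul c b hb => simp only [map_smul, LinearMap.smul_apply, hb]
    | hadd a a' ha ha' => simp only [map_add, LinearMap.add_apply, ha, ha']
    | hsmul c a ha => simp only [map_smul, LinearMap.smul_apply, ha]
  H_H a b m := by
    induction a using laurent_induction with
    | hT n =>
      induction b using laurent_induction with
      | hT k => simp [Verma.opH_opH _ n k]
      | hadd b b' hb hb' => simp only [map_add, LinearMap.add_apply, hb, hb']
      | hsmul c b hb => simp only [map_smul, LinearMap.smul_apply, hb]
    | hadd a a' ha ha' => simp only [map_add, LinearMap.add_apply, ha, ha']
    | hsmul c a ha => simp only [map_smul, LinearMap.smul_apply, ha]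

theorem verma_isHighest (φ : ℂ[T;T⁻¹] →ₗ[ℂ] ℂ) :
    (verma φ).IsHighest φ (1 : MvPolynomial ℤ ℂ) where
  E_eq a := by
    induction a using laurent_induction with
    | hT n => simp [verma, Verma.opE_one]
    | hadd a a' ha ha' => rw [map_add, LinearMap.add_apply, ha, ha', add_zero]
    | hsmul c a ha => rw [map_smul, LinearMap.smul_apply, ha, smul_zero]
  H_eq a := by
    induction a using laurent_induction with
    | hT n => simp [verma, Verma.opH_one]
    | hadd a a' ha ha' => rw [map_add, LinearMap.add_apply, ha, ha', map_add, add_smul]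
    | hsmul c a ha => rw [map_smul, LinearMap.smul_apply, ha, map_smul, smul_assoc]

/-! ### Representations of the loop algebra of `sl₂` -/

theorem lie_e_f : ⁅e, f⁆ = h := by
  ext i j
  fin_cases i <;> fin_cases j <;> simp [e, f, h, LieSubalgebra.coe_bracket, Ring.lie_def]

theorem lie_h_e : ⁅h, e⁆ = (2 : ℂ) • e := by
  ext i j
  fin_cases i <;> fin_cases j <;> simp [e, h, LieSubalgebra.coe_bracket, Ring.lie_def]
  norm_num

theorem lie_h_f : ⁅h, f⁆ = -((2 : ℂ) • f) := by
  ext i j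
  fin_cases i <;> fin_cases j <;> simp [f, h, LieSubalgebra.coe_bracket, Ring.lie_def]
  norm_num

theorem sl2_trace (x : Sl2) : x.1 1 1 = -x.1 0 0 := by
  have hx : x.1.trace = 0 := by
    simpa [LieAlgebra.SpecialLinear.sl] using x.2
  rw [Matrix.trace_fin_two] at hx
  linear_combination hx

theorem sl2_eq (x : Sl2) : x = x.1 0 1 • e + x.1 1 0 • f + x.1 0 0 • h := by
  ext i j
  fin_cases i <;> fin_cases j <;> simp [e, f, h, sl2_trace]

/-- The entries of a matrix in `sl₂`, as linear functionals. -/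
def entry (i j : Fin 2) : Sl2 →ₗ[ℂ] ℂ :=
  Matrix.entryLinearMap ℂ ℂ i j ∘ₗ (Submodule.subtype _)

theorem entry_apply (i j : Fin 2) (x : Sl2) : entry i j x = x.1 i j := rfl

theorem entry_lie (x y : Sl2) (i j : Fin 2) :
    entry i j ⁅x, y⁆ = x.1 i 0 * y.1 0 j + x.1 i 1 * y.1 1 j -
      (y.1 i 0 * x.1 0 j + y.1 i 1 * x.1 1 j) := by
  simp [entry_apply, LieSubalgebra.coe_bracket, Ring.lie_def, Matrix.mul_apply]

namespace CurrentRep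

attribute [local instance 100] LieRing.ofAssociativeRing

variable {A M : Type} [CommRing A] [Algebra ℂ A] [AddCommGroup M] [Module ℂ M]

/-- The operator of `a ⊗ x`. -/
def op (ρ : CurrentRep A M) : A →ₗ[ℂ] Sl2 →ₗ[ℂ] Module.End ℂ M :=
  LinearMap.mk₂ ℂ (fun a x => entry 0 1 x • ρ.E a + entry 1 0 x • ρ.F a + entry 0 0 x • ρ.H a)
    (fun a b x => by simp only [map_add]; module) (fun c a x => by simp only [map_smul]; module)
    (fun a x y => by simp only [map_add]; module)
    (fun c a x => by simp only [map_smul, smul_eq_mul]; module)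

theorem op_apply (ρ : CurrentRep A M) (a : A) (x : Sl2) (m : M) :
    ρ.op a x m = x.1 0 1 • ρ.E a m + x.1 1 0 • ρ.F a m + x.1 0 0 • ρ.H a m := rfl

theorem op_lie (ρ : CurrentRep A M) (a b : A) (x y : Sl2) :
    ρ.op (a * b) ⁅x, y⁆ = ⁅ρ.op a x, ρ.op b y⁆ := by
  ext m
  rw [op_apply, Ring.lie_def, LinearMap.sub_apply, Module.End.mul_apply, Module.End.mul_apply]
  simp only [← entry_apply _ _ ⁅x, y⁆, entry_lie, sl2_trace, op_apply, map_add, map_smul, ρ.E_F,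
    ρ.H_E, ρ.H_F, ρ.E_E b a, ρ.F_F b a, ρ.H_H b a, mul_comm b a]
  module

/-- The homomorphism of Lie algebras defined by a representation. -/
def toLie (ρ : CurrentRep A M) : A ⊗[ℂ] Sl2 →ₗ⁅ℂ⁆ Module.End ℂ M where
  toLinearMap := TensorProduct.lift ρ.op
  map_lie' {x y} := by
    change TensorProduct.lift ρ.op ⁅x, y⁆ = ⁅TensorProduct.lift ρ.op x, TensorProduct.lift ρ.op y⁆
    induction x using TensorProduct.induction_on with
    | zero => simp
    | add x x' hx hx' => rw [add_lie, map_add, map_add, hx, hx', add_lie]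
    | tmul a x =>
      induction y using TensorProduct.induction_on with
      | zero => exact (congrArg (TensorProduct.lift ρ.op) (lie_zero (a ⊗ₜ[ℂ] x))).trans (by simp)
      | add y y' hy hy' => rw [LieRing.lie_add, map_add, map_add, hy, hy', lie_add]
      | tmul b y => simp [LieAlgebra.ExtendScalars.bracket_tmul, op_lie]

theorem toLie_e (ρ : CurrentRep A M) (a : A) : ρ.toLie (a ⊗ₜ e) = ρ.E a := by
  change ρ.op a e = _
  ext m
  simp [op_apply, e]

theorem toLie_h (ρ : CurrentRep A M) (a : A) : ρ.toLie (a ⊗ₜ h) = ρ.H a := by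
  change ρ.op a h = _
  ext m
  simp [op_apply, h]

/-- The representation defined by a homomorphism of Lie algebras. -/
def ofLie (r : A ⊗[ℂ] Sl2 →ₗ⁅ℂ⁆ Module.End ℂ M) : CurrentRep A M :=
  have key (a b : A) (x y : Sl2) (m : M) : r (a ⊗ₜ x) (r (b ⊗ₜ y) m) =
      r (b ⊗ₜ y) (r (a ⊗ₜ x) m) + r ((a * b) ⊗ₜ ⁅x, y⁆) m := by
    rw [← LieAlgebra.ExtendScalars.bracket_tmul, LieHom.map_lie, Ring.lie_def,
      LinearMap.sub_apply, Module.End.mul_apply, Module.End.mul_apply, add_sub_cancel]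
  { E := r.toLinearMap ∘ₗ (TensorProduct.mk ℂ A Sl2).flip e
    F := r.toLinearMap ∘ₗ (TensorProduct.mk ℂ A Sl2).flip f
    H := r.toLinearMap ∘ₗ (TensorProduct.mk ℂ A Sl2).flip h
    E_F := fun a b m => by simp [key a b e, lie_e_f]
    H_E := fun a b m => by simp [key a b h, lie_h_e, TensorProduct.tmul_smul]
    H_F := fun a b m => by
      simp [key a b h, lie_h_f, TensorProduct.tmul_smul, TensorProduct.tmul_neg, sub_eq_add_neg]
    E_E := fun a b m => by simp [key a b e]
    F_F := fun a b m => by simp [key a b f]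
    H_H := fun a b m => by simp [key a b h] }

theorem IsStable.mem {r : A ⊗[ℂ] Sl2 →ₗ⁅ℂ⁆ Module.End ℂ M} {N : Submodule ℂ M}
    (hN : (ofLie r).IsStable N) (x : A ⊗[ℂ] Sl2) {m : M} (hm : m ∈ N) : r x m ∈ N := by
  induction x using TensorProduct.induction_on with
  | zero => simp
  | add x y hx hy => rw [map_add]; exact add_mem hx hy
  | tmul a x =>
    rw [sl2_eq x]
    simp only [TensorProduct.tmul_add, TensorProduct.tmul_smul, map_add, map_smul]
    exact add_mem (add_mem (N.smul_mem _ (hN.E_mem a m hm)) (N.smul_mem _ (hN.F_mem a m hm)))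
      (N.smul_mem _ (hN.H_mem a m hm))

end CurrentRep

/-! ### The twisted loop algebra of type `ΔA₁` -/

namespace DeltaA1

/-- The projection of `Ltw` to the first summand. -/
def toLoop : Ltw →ₗ⁅ℂ⁆ Loop Sl2 :=
  (LieAlgebra.ExtendScalars.map (AlgHom.id ℂ ℂ[T;T⁻¹]) (LieHom.fst ℂ Sl2 Sl2)).comp Ltw.incl

/-- The map `a ⊗ x ↦ a ⊗ (x, 0) + θ (a ⊗ (x, 0))`. -/
def ofLoop : Loop Sl2 →ₗ[ℂ] Loop (Sl2 × Sl2) :=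
  TensorProduct.map LinearMap.id (LinearMap.inl ℂ Sl2 Sl2) +
    TensorProduct.map (LaurentPolynomial.invert : ℂ[T;T⁻¹] ≃ₐ[ℂ] ℂ[T;T⁻¹]).toLinearMap
      (LinearMap.inr ℂ Sl2 Sl2)

theorem ofLoop_tmul (a : ℂ[T;T⁻¹]) (x : Sl2) :
    ofLoop (a ⊗ₜ x) = a ⊗ₜ (x, 0) + LaurentPolynomial.invert a ⊗ₜ (0, x) := rfl

theorem ofLoop_mem (x : Loop Sl2) : ofLoop x ∈ Ltw := by
  change loopTheta theta (ofLoop x) = ofLoop x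
  induction x using TensorProduct.induction_on with
  | zero => simp
  | add x y hx hy => rw [map_add, map_add, hx, hy]
  | tmul a x => simp [ofLoop_tmul, loopTheta, theta, LaurentPolynomial.involutive_invert a, add_comm]

theorem fst_ofLoop (x : Loop Sl2) :
    LieAlgebra.ExtendScalars.map (AlgHom.id ℂ ℂ[T;T⁻¹]) (LieHom.fst ℂ Sl2 Sl2) (ofLoop x) = x := by
  induction x using TensorProduct.induction_on with
  | zero => simp
  | add x y hx hy => rw [map_add, map_add, hx, hy]
  | tmul a x => simp [ofLoop_tmul]

/-- Fixed points are not given as sums of fixed pure tensors, so the identity is proved on the whole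
loop algebra, with an error term that vanishes when `loopTheta theta x = x`. -/
theorem ofLoop_fst (x : Loop (Sl2 × Sl2)) :
    ofLoop (LieAlgebra.ExtendScalars.map (AlgHom.id ℂ ℂ[T;T⁻¹]) (LieHom.fst ℂ Sl2 Sl2) x) =
      x + TensorProduct.map LinearMap.id (LinearMap.inr ℂ Sl2 Sl2 ∘ₗ LinearMap.snd ℂ Sl2 Sl2)
        (loopTheta theta x - x) := by
  induction x using TensorProduct.induction_on with
  | zero => simp
  | add x y hx hy =>
    simp only [map_add, map_sub, hx, hy]
    abel
  | tmul a x =>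
    have hx : a ⊗ₜ[ℂ] x = a ⊗ₜ[ℂ] (x.1, (0 : Sl2)) + a ⊗ₜ[ℂ] ((0 : Sl2), x.2) := by
      rw [← TensorProduct.tmul_add, Prod.mk_add_mk, add_zero, zero_add]
    simp only [loopTheta, LieAlgebra.ExtendScalars.map_apply_tmul, map_sub,
      TensorProduct.map_tmul, ofLoop_tmul]
    simp [theta, hx]

/-- The twisted loop algebra of type `ΔA₁` is isomorphic to the loop algebra of `sl₂`. -/
def loopEquiv : Ltw ≃ₗ⁅ℂ⁆ Loop Sl2 :=
  { toLoop with
    invFun := fun x => ⟨ofLoop x, ofLoop_mem x⟩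
    left_inv := fun x => Subtype.ext <| (ofLoop_fst x.1).trans <| by
      rw [show loopTheta theta x.1 = x.1 from x.2, sub_self, map_zero, add_zero]
    right_inv := fst_ofLoop }

theorem coe_loopEquiv_symm (x : Loop Sl2) : (loopEquiv.symm x : Loop (Sl2 × Sl2)) = ofLoop x := rfl

theorem ofLoop_tmul_mem_loopSub (a : ℂ[T;T⁻¹]) (x : Sl2) :
    ofLoop (a ⊗ₜ x) ∈ loopSub (Submodule.span ℂ {(x, 0), (0, x)}) := by
  refine Submodule.add_mem _ ?_ ?_
  · exact ⟨a ⊗ₜ ⟨_, Submodule.subset_span (Or.inl rfl)⟩, rfl⟩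
  · exact ⟨LaurentPolynomial.invert a ⊗ₜ ⟨_, Submodule.subset_span (Or.inr rfl)⟩, rfl⟩

theorem exists_fst_eq_tmul {s : Sl2} {y : Loop (Sl2 × Sl2)}
    (hy : y ∈ loopSub (Submodule.span ℂ {(s, 0), (0, s)})) :
    ∃ a : ℂ[T;T⁻¹], LieAlgebra.ExtendScalars.map (AlgHom.id ℂ ℂ[T;T⁻¹]) (LieHom.fst ℂ Sl2 Sl2) y =
      a ⊗ₜ s := by
  obtain ⟨z, rfl⟩ := hy
  induction z using TensorProduct.induction_on with
  | zero => exact ⟨0, by simp⟩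
  | add x y hx hy =>
    obtain ⟨a, ha⟩ := hx
    obtain ⟨b, hb⟩ := hy
    exact ⟨a + b, by rw [map_add, map_add, ha, hb, TensorProduct.add_tmul]⟩
  | tmul p w =>
    obtain ⟨w, hw⟩ := w
    obtain ⟨c, d, rfl⟩ := Submodule.mem_span_pair.1 hw
    exact ⟨c • p, by simp [TensorProduct.smul_tmul]⟩

theorem symm_e_mem (a : ℂ[T;T⁻¹]) : loopEquiv.symm (a ⊗ₜ e) ∈ LtwPos :=
  ofLoop_tmul_mem_loopSub a e

/-- The element of `LtwZero` corresponding to `a ⊗ h`. -/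
def zeroElt : ℂ[T;T⁻¹] →ₗ[ℂ] LtwZero :=
  (loopEquiv.symm.toLinearMap ∘ₗ (TensorProduct.mk ℂ ℂ[T;T⁻¹] Sl2).flip h).codRestrict LtwZero
    fun a => ofLoop_tmul_mem_loopSub a h

theorem coe_zeroElt (a : ℂ[T;T⁻¹]) : (zeroElt a : Ltw) = loopEquiv.symm (a ⊗ₜ h) := rfl

theorem zeroElt_T (n : ℤ) : zeroElt (LaurentPolynomial.T n) = w n := by
  refine Subtype.ext (Subtype.ext ?_)
  rw [coe_zeroElt, coe_loopEquiv_symm, ofLoop_tmul, LaurentPolynomial.invert_T]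
  rfl

theorem exists_loopEquiv_eq_of_mem_pos {x : Ltw} (hx : x ∈ LtwPos) :
    ∃ a : ℂ[T;T⁻¹], loopEquiv x = a ⊗ₜ e :=
  exists_fst_eq_tmul hx

theorem exists_zeroElt_eq (x : LtwZero) : ∃ a : ℂ[T;T⁻¹], zeroElt a = x := by
  obtain ⟨a, ha⟩ := exists_fst_eq_tmul x.2
  refine ⟨a, Subtype.ext (loopEquiv.injective ?_)⟩
  exact (loopEquiv.apply_symm_apply _).trans ha.symm

end DeltaA1

attribute [local instance 100] LieRing.ofAssociativeRing

/-! ### Modules over the universal enveloping algebra -/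

/-- The elements of the enveloping algebra that preserve `N` form a subalgebra containing the image
of `L`; by the universal property it is everything. -/
theorem smul_mem_of_ι_smul_mem {L M : Type*} [LieRing L] [LieAlgebra ℂ L] [AddCommGroup M]
    [Module ℂ M] [Module (UniversalEnvelopingAlgebra ℂ L) M]
    [IsScalarTower ℂ (UniversalEnvelopingAlgebra ℂ L) M] {N : Submodule ℂ M}
    (hN : ∀ x : L, ∀ m ∈ N, UniversalEnvelopingAlgebra.ι ℂ x • m ∈ N)
    (u : UniversalEnvelopingAlgebra ℂ L) {m : M} (hm : m ∈ N) : u • m ∈ N := by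
  let S : Subalgebra ℂ (UniversalEnvelopingAlgebra ℂ L) :=
    { carrier := {u | ∀ m ∈ N, u • m ∈ N}
      mul_mem' := fun {a b} ha hb m hm => by rw [mul_smul]; exact ha _ (hb _ hm)
      add_mem' := fun {a b} ha hb m hm => by rw [add_smul]; exact add_mem (ha _ hm) (hb _ hm)
      algebraMap_mem' := fun c m hm => by rw [algebraMap_smul]; exact N.smul_mem c hm }
  let j : L →ₗ⁅ℂ⁆ S :=
    { toFun := fun x => ⟨UniversalEnvelopingAlgebra.ι ℂ x, hN x⟩
      map_add' := fun x y => Subtype.ext (map_add _ x y)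
      map_smul' := fun c x => Subtype.ext (map_smul _ c x)
      map_lie' := fun {x y} => Subtype.ext (LieHom.map_lie _ x y) }
  have hj : S.val.comp (UniversalEnvelopingAlgebra.lift ℂ j) = AlgHom.id ℂ _ := by
    ext x
    change S.val (UniversalEnvelopingAlgebra.lift ℂ j (UniversalEnvelopingAlgebra.ι ℂ x)) = _
    rw [UniversalEnvelopingAlgebra.lift_ι_apply]
    rfl
  have hu : (UniversalEnvelopingAlgebra.lift ℂ j u : UniversalEnvelopingAlgebra ℂ L) = u :=
    DFunLike.congr_fun hj u
  exact hu ▸ (UniversalEnvelopingAlgebra.lift ℂ j u).2 m hm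

namespace DeltaA1

section ModuleRep

variable (M : Type) [AddCommGroup M] [Module ℂ M] [Module (UniversalEnvelopingAlgebra ℂ Ltw) M]
  [IsScalarTower ℂ (UniversalEnvelopingAlgebra ℂ Ltw) M]

/-- A module over `U(Ltw)` as a representation of the loop algebra of `sl₂`. -/
def moduleLie : Loop Sl2 →ₗ⁅ℂ⁆ Module.End ℂ M :=
  ((Algebra.lsmul ℂ ℂ M : UniversalEnvelopingAlgebra ℂ Ltw →ₐ[ℂ] Module.End ℂ M).toLieHom.comp
    (UniversalEnvelopingAlgebra.ι ℂ)).comp loopEquiv.symm.toLieHom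

theorem moduleLie_apply (x : Loop Sl2) (m : M) :
    moduleLie M x m = UniversalEnvelopingAlgebra.ι ℂ (loopEquiv.symm x) • m := rfl

/-- The representation defined by a module over `U(Ltw)`. -/
def moduleRep : CurrentRep ℂ[T;T⁻¹] M := CurrentRep.ofLie (moduleLie M)

variable {M}

theorem smul_mem_of_isStable {N : Submodule ℂ M} (hN : (moduleRep M).IsStable N)
    (u : UniversalEnvelopingAlgebra ℂ Ltw) {m : M} (hm : m ∈ N) : u • m ∈ N := by
  refine smul_mem_of_ι_smul_mem (fun x m hm => ?_) u hm
  have := hN.mem (loopEquiv x) hm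
  rwa [moduleLie_apply, LieEquiv.symm_apply_apply] at this

theorem isStable_restrictScalars (N : Submodule (UniversalEnvelopingAlgebra ℂ Ltw) M) :
    (moduleRep M).IsStable (N.restrictScalars ℂ) :=
  ⟨fun _ _ hm => N.smul_mem _ hm, fun _ _ hm => N.smul_mem _ hm, fun _ _ hm => N.smul_mem _ hm⟩

theorem isHighest_map {M' : Type} [AddCommGroup M'] [Module ℂ M']
    [Module (UniversalEnvelopingAlgebra ℂ Ltw) M']
    [IsScalarTower ℂ (UniversalEnvelopingAlgebra ℂ Ltw) M']
    (g : M →ₗ[UniversalEnvelopingAlgebra ℂ Ltw] M') {ψ : ℂ[T;T⁻¹] →ₗ[ℂ] ℂ} {v : M}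
    (hv : (moduleRep M).IsHighest ψ v) : (moduleRep M').IsHighest ψ (g v) where
  E_eq a := by
    have := congrArg g (hv.E_eq a)
    rw [map_zero] at this
    exact (g.map_smul _ v).symm.trans this
  H_eq a := by
    have := congrArg g (hv.H_eq a)
    rw [LinearMap.map_smul_of_tower] at this
    exact (g.map_smul _ v).symm.trans this

end ModuleRep

/-! ### Highest weight modules of `Ltw` -/

variable (φ : Module.Dual ℂ LtwZero)

/-- The weight `φ`, as a functional on Laurent polynomials. -/
def weight : ℂ[T;T⁻¹] →ₗ[ℂ] ℂ := φ ∘ₗ zeroElt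

/-- The generator of `M(φ)`. -/
def generator : universalHW LtwPos LtwZero φ := (hwIdeal LtwPos LtwZero φ).mkQ 1

theorem smul_generator (u : UniversalEnvelopingAlgebra ℂ Ltw) :
    u • generator φ = (hwIdeal LtwPos LtwZero φ).mkQ u := by
  rw [generator, ← map_smul, smul_eq_mul, mul_one]

theorem generator_isHighest :
    (moduleRep (universalHW LtwPos LtwZero φ)).IsHighest (weight φ) (generator φ) where
  E_eq a := by
    refine (smul_generator φ _).trans ?_
    rw [Submodule.mkQ_apply, Submodule.Quotient.mk_eq_zero]
    exact Submodule.subset_span (Or.inl ⟨_, symm_e_mem a, rfl⟩)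
  H_eq a := by
    refine (smul_generator φ _).trans ?_
    rw [← algebraMap_smul (UniversalEnvelopingAlgebra ℂ Ltw) (weight φ a), smul_generator,
      ← sub_eq_zero, ← map_sub, Submodule.mkQ_apply, Submodule.Quotient.mk_eq_zero]
    exact Submodule.subset_span (Or.inr ⟨zeroElt a, rfl⟩)

theorem eq_top_of_generator_mem {N : Submodule ℂ (universalHW LtwPos LtwZero φ)}
    (hN : (moduleRep (universalHW LtwPos LtwZero φ)).IsStable N) (h : generator φ ∈ N) :
    N = ⊤ := by
  refine eq_top_iff.2 fun m _ => ?_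
  obtain ⟨u, rfl⟩ := Submodule.mkQ_surjective _ m
  rw [← smul_generator]
  exact smul_mem_of_isStable hN u h

variable {φ}

section Universal

variable {M : Type} [AddCommGroup M] [Module ℂ M] {ρ : CurrentRep ℂ[T;T⁻¹] M} {v : M}

/-- The homomorphism from `U(Ltw)` defined by a representation. -/
def envelope (ρ : CurrentRep ℂ[T;T⁻¹] M) :
    UniversalEnvelopingAlgebra ℂ Ltw →ₐ[ℂ] Module.End ℂ M :=
  UniversalEnvelopingAlgebra.lift ℂ (ρ.toLie.comp loopEquiv.toLieHom)

theorem envelope_ι (x : Ltw) :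
    envelope ρ (UniversalEnvelopingAlgebra.ι ℂ x) = ρ.toLie (loopEquiv x) :=
  UniversalEnvelopingAlgebra.lift_ι_apply ..

/-- The annihilator of a vector, as a left ideal of `U(Ltw)`. -/
def annihilator (ρ : CurrentRep ℂ[T;T⁻¹] M) (v : M) :
    Submodule (UniversalEnvelopingAlgebra ℂ Ltw) (UniversalEnvelopingAlgebra ℂ Ltw) where
  carrier := {u | envelope ρ u v = 0}
  add_mem' {a b} ha hb := by
    rw [Set.mem_ofPred_eq] at *
    rw [map_add, LinearMap.add_apply, ha, hb, add_zero]
  zero_mem' := by simp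
  smul_mem' c u hu := by
    rw [Set.mem_ofPred_eq] at *
    rw [smul_eq_mul, map_mul, Module.End.mul_apply, hu, map_zero]

theorem hwIdeal_le_annihilator (hv : ρ.IsHighest (weight φ) v) :
    hwIdeal LtwPos LtwZero φ ≤ annihilator ρ v := by
  refine Submodule.span_le.2 ?_
  rintro _ (⟨x, hx, rfl⟩ | ⟨x, rfl⟩)
  · obtain ⟨a, ha⟩ := exists_loopEquiv_eq_of_mem_pos hx
    change envelope ρ _ v = 0
    rw [envelope_ι, ha, CurrentRep.toLie_e, hv.E_eq]
  · obtain ⟨a, rfl⟩ := exists_zeroElt_eq x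
    change envelope ρ _ v = 0
    rw [map_sub, envelope_ι, coe_zeroElt, LieEquiv.apply_symm_apply, CurrentRep.toLie_h,
      LinearMap.sub_apply, hv.H_eq, AlgHom.commutes, Module.algebraMap_end_apply, sub_eq_zero]
    rfl

theorem one_notMem_annihilator (h0 : v ≠ 0) : 1 ∉ annihilator ρ v := fun h => h0 <| by
  have h' : envelope ρ 1 v = 0 := h
  rwa [map_one] at h'

/-- The annihilator contains `hwIdeal` but not `1`, so its image in `M(φ)` is a proper submodule. -/
theorem map_annihilator_le (hv : ρ.IsHighest (weight φ) v) (h0 : v ≠ 0) :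
    (annihilator ρ v).map (hwIdeal LtwPos LtwZero φ).mkQ ≤ maxSubmodule LtwPos LtwZero φ := by
  refine le_sSup fun htop => one_notMem_annihilator h0 (ρ := ρ) ?_
  have h := (Submodule.map_mkQ_eq_top _ _).1 htop
  rw [sup_eq_right.2 (hwIdeal_le_annihilator hv)] at h
  exact h ▸ Submodule.mem_top

/-- `V φ` is a quotient of `U(Ltw)` modulo the annihilator of `v`, and that quotient embeds into `M`
by `u ↦ u v`. -/
theorem finiteDimensional_V [FiniteDimensional ℂ M] (hv : ρ.IsHighest (weight φ) v) (h0 : v ≠ 0) :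
    FiniteDimensional ℂ (V φ) := by
  let g : UniversalEnvelopingAlgebra ℂ Ltw →ₗ[ℂ] M :=
    LinearMap.applyₗ v ∘ₗ (envelope ρ).toLinearMap
  let s : UniversalEnvelopingAlgebra ℂ Ltw →ₗ[ℂ] V φ :=
    ((maxSubmodule LtwPos LtwZero φ).mkQ ∘ₗ (hwIdeal LtwPos LtwZero φ).mkQ).restrictScalars ℂ
  have hs : Function.Surjective s :=
    (Submodule.mkQ_surjective _).comp (Submodule.mkQ_surjective _)
  have hle : LinearMap.ker g ≤ LinearMap.ker s := fun u hu =>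
    (Submodule.Quotient.mk_eq_zero _).2 (map_annihilator_le hv h0 ⟨u, hu, rfl⟩)
  have := g.quotKerEquivRange.symm.finiteDimensional
  refine Module.Finite.of_surjective ((LinearMap.ker g).liftQ s hle) fun x => ?_
  obtain ⟨u, rfl⟩ := hs x
  exact ⟨(LinearMap.ker g).mkQ u, rfl⟩

end Universal

variable (φ)

/-- The Verma module on polynomials has a nonzero highest weight vector of this weight, so `1 ∉
hwIdeal`; this replaces an appeal to the Poincaré–Birkhoff–Witt theorem. -/
theorem generator_ne_zero : generator φ ≠ 0 := fun h => by
  rw [generator, Submodule.mkQ_apply, Submodule.Quotient.mk_eq_zero] at h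
  exact one_notMem_annihilator one_ne_zero (hwIdeal_le_annihilator (verma_isHighest (weight φ)) h)

/-- Every proper submodule lies in the sum of the other weight spaces, hence so does their sum,
whereas the generator does not. -/
theorem generator_notMem_maxSubmodule : generator φ ∉ maxSubmodule LtwPos LtwZero φ := fun h => by
  have hv := generator_isHighest φ
  refine hv.notMem_otherWeights (generator_ne_zero φ) ?_
  rw [maxSubmodule, sSup_eq_iSup'] at h
  refine Submodule.iSup_induction _ (motive := (· ∈ CurrentRep.otherWeights _ _)) h
    (fun N x hx => ?_) (zero_mem _) fun x y hx hy => add_mem hx hy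
  refine hv.le_otherWeights (fun N hN h => eq_top_of_generator_mem φ hN h)
    (isStable_restrictScalars N.1) (fun hmem => N.2 ?_) hx
  rw [← Submodule.restrictScalars_eq_top_iff ℂ]
  exact eq_top_of_generator_mem φ (isStable_restrictScalars N.1) hmem

variable {φ} in
theorem eq_bot_of_notMem {N : Submodule (UniversalEnvelopingAlgebra ℂ Ltw) (V φ)}
    (h : (maxSubmodule LtwPos LtwZero φ).mkQ (generator φ) ∉ N) : N = ⊥ := by
  have hle : N.comap (maxSubmodule LtwPos LtwZero φ).mkQ ≤ maxSubmodule LtwPos LtwZero φ := by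
    refine le_sSup fun htop => h ?_
    rw [← Submodule.mem_comap, htop]
    exact Submodule.mem_top
  refine eq_bot_iff.2 fun m hm => ?_
  obtain ⟨m, rfl⟩ := Submodule.mkQ_surjective _ m
  rw [Submodule.mem_bot, Submodule.mkQ_apply, Submodule.Quotient.mk_eq_zero]
  exact hle hm

theorem exists_eq_sum_of_finiteDimensional [FiniteDimensional ℂ (V φ)] :
    ∃ (n : ℕ) (χ : Fin n → ℂ[T;T⁻¹] →ₐ[ℂ] ℂ), ∀ a, weight φ a = ∑ i, χ i a := by
  refine (isHighest_map (maxSubmodule LtwPos LtwZero φ).mkQ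
    (generator_isHighest φ)).exists_eq_sum ?_ fun N hN hvN => ?_
  · rw [Submodule.mkQ_apply, Ne, Submodule.Quotient.mk_eq_zero]
    exact generator_notMem_maxSubmodule φ
  -- A stable complex subspace is a submodule over `U(Ltw)`, so the simplicity of `V φ` applies to
  -- it.
  · have h := eq_bot_of_notMem (N := Submodule.mk N.toAddSubmonoid
      fun u _ hm => smul_mem_of_isStable hN u hm) hvN
    exact eq_bot_iff.2 fun m hm => h.le hm

end DeltaA1

/-! ### Characters of the ring of Laurent polynomials -/

/-- Every character of the ring of Laurent polynomials is the evaluation at a nonzero number. -/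
theorem exists_apply_T_eq_zpow (χ : ℂ[T;T⁻¹] →ₐ[ℂ] ℂ) :
    ∃ α : ℂˣ, ∀ a : ℤ, χ (LaurentPolynomial.T a) = (α : ℂ) ^ a := by
  let g : Multiplicative ℤ →* ℂˣ :=
    ((χ : ℂ[T;T⁻¹] →* ℂ).comp (AddMonoidAlgebra.of ℂ ℤ)).toHomUnits
  refine ⟨g (Multiplicative.ofAdd 1), fun a => ?_⟩
  rw [← Units.val_zpow_eq_zpow_val, ← map_zpow, ← ofAdd_zsmul, smul_eq_mul, mul_one]
  rfl

/-- The evaluation of Laurent polynomials at a nonzero number. -/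
theorem exists_algHom_apply_T_eq_zpow (α : ℂˣ) :
    ∃ χ : ℂ[T;T⁻¹] →ₐ[ℂ] ℂ, ∀ a : ℤ, χ (LaurentPolynomial.T a) = (α : ℂ) ^ a := by
  refine ⟨AddMonoidAlgebra.lift ℂ ℂ ℤ ((Units.coeHom ℂ).comp (zpowersHom ℂˣ α)), fun a => ?_⟩
  refine (AddMonoidAlgebra.lift_of' _ a).trans ?_
  simp

end TwistedLoop

end

open TwistedLoop DeltaA1 in
theorem mainTheorem2 :
    Nonempty (TwistedLoop.DeltaA1.Ltw ≃ₗ⁅ℂ⁆ TwistedLoop.Loop TwistedLoop.Sl2) ∧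
    ∀ φ : Module.Dual ℂ TwistedLoop.DeltaA1.LtwZero,
      FiniteDimensional ℂ (TwistedLoop.DeltaA1.V φ) ↔
        ∃ (n : ℕ) (α : Fin n → ℂˣ), ∀ a : ℤ,
          φ (TwistedLoop.DeltaA1.w a) = ∑ i, ((α i : ℂ) ^ a) := by
  refine ⟨⟨loopEquiv⟩, fun φ => ⟨fun _ => ?_, ?_⟩⟩
  · obtain ⟨n, χ, h⟩ := exists_eq_sum_of_finiteDimensional φ
    choose α hα using fun i => exists_apply_T_eq_zpow (χ i)
    refine ⟨n, α, fun a => ?_⟩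
    rw [← zeroElt_T]
    exact (h _).trans (Finset.sum_congr rfl fun i _ => hα i a)
  · rintro ⟨n, α, h⟩
    choose χ hχ using fun i => exists_algHom_apply_T_eq_zpow (α i)
    obtain ⟨M, _, _, _, ρ, v, h0, hv⟩ := CurrentRep.exists_finiteDimensional n χ
    have hw : ∑ i, (χ i).toLinearMap = weight φ := by
      refine LinearMap.ext fun a => ?_
      induction a using laurent_induction with
      | hT a =>
        rw [LinearMap.sum_apply, weight, LinearMap.comp_apply, zeroElt_T, h]
        exact Finset.sum_congr rfl fun i _ => hχ i a
      | hadd a b ha hb => rw [map_add, map_add, ha, hb]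
      | hsmul c a ha => rw [map_smul, map_smul, ha]
    exact finiteDimensional_V (hw ▸ hv) h0
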